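/- Let $k$ be a field of characteristic $\neq 2$ and let $\mathfrak C$ be an octonion algebra over $k$, i.e. a (not necessarily associative) unital $k$-algebra of dimension $8$ with a nondegenerate quadratic form $N$ such that $N(xy)=N(x)N(y)$ for all $x,y$; write $N(x,y)=N(x+y)-N(x)-N(y)$, and let $G(k)=\mathrm{Aut}(\mathfrak C)$ be the group of $k$-algebra automorphisms of $\mathfrak C$. Let $L\subset\mathfrak C$ be a unital subalgebra which is a quadratic field extension of $k$, $L=k(\gamma)$ with $\gamma^2\in k$, and let $\sigma$ be the nontrivial $k$-automorphism of $L$. Let $V=L^\perp$ be the orthogonal complement of $L$ with respect to $N(\cdot,\cdot)$; it is a left $L$-vector space of dimension $3$ via the multiplication of $\mathfrak C$, with nondegenerate hermitian form $h(x,y)=N(x,y)+\gamma^{-1}N(\gamma x,y)$. Let $G(\mathfrak C/L)$ be the group of those $t\in\mathrm{Aut}(\mathfrak C)$ that fix $L$ pointwise; such a $t$ restricts to an $L$-linear map $V\to V$. Choose $a\in L^\perp$ with $N(a)\neq 0$, put $\mathfrak D=L\oplus La$, and choose $b\in\mathfrak D^\perp$ with $N(b)\neq 0$. Then $f_1=a$,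 $f_2=b$, $f_3=ab$ is an orthogonal basis of $V$ over $L$; put $H=\mathrm{diag}(h(f_1,f_1),h(f_2,f_2),h(f_3,f_3))$ and $$SU(H)=\{A\in SL(3,L)\mid {}^tA\,H\,\bar A=H\},$$ where $\bar A$ is obtained by applying $\sigma$ to the entries of $A$. Let $t_0\in G(\mathfrak C/L)$ and let $A$ be the matrix of $t_0|_V$ with respect to the basis $f_1,f_2,f_3$ (the $j$-th column holds the coordinates of $t_0(f_j)$). Suppose that the characteristic polynomial of $A$ is irreducible over $L$. Then $A$ and $\bar A$ belong to $SU(H)$, and $t_0$ is conjugate to $t_0^{-1}$ in $G(k)$ if and only if $\bar A$ is conjugate to $A^{-1}$ in $SU(H)$. -/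

import Mathlib

open QuadraticMap

namespace OctonionReality

/-- An octonion algebra structure on the (not necessarily associative) unital `k`-algebra `C`:
a nondegenerate quadratic form `N` on `C` permitting composition, `C` being of dimension `8`.
The bilinear form associated with `N` is `N(x, y) = N(x + y) - N(x) - N(y)`,
that is, `polar N x y`. -/
structure OctonionAlgebra (k C : Type*) [Field k] [NonAssocRing C] [Module k C]
    [IsScalarTower k C C] [SMulCommClass k C C] where
  /-- the norm -/
  norm : QuadraticForm k C
  norm_mul : ∀ x y : C, norm (x * y) = norm x * norm y
  nondegenerate : (polarBilin norm).Nondegenerate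
  finrank_eq : Module.finrank k C = 8

/-- The group of `k`-algebra automorphisms of a not necessarily associative `k`-algebra. -/
def Aut (k C : Type*) [Field k] [NonAssocRing C] [Module k C] : Subgroup (C ≃ₗ[k] C) where
  carrier := {t | ∀ x y : C, t (x * y) = t x * t y}
  one_mem' := fun _ _ => rfl
  mul_mem' := by
    intro s t hs ht x y
    change s (t (x * y)) = s (t x) * s (t y)
    rw [ht, hs]
  inv_mem' := by
    intro t ht x y
    apply t.injective
    have e : ∀ z, t ((t⁻¹ : C ≃ₗ[k] C) z) = z := fun z => t.apply_symm_apply z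
    rw [ht, e, e, e]

theorem aut_one {k C : Type*} [Field k] [NonAssocRing C] [Module k C] (t : Aut k C) :
    t.1 1 = 1 := by
  have h : ∀ y, t.1 1 * y = y := fun y => by
    obtain ⟨x, rfl⟩ := t.1.surjective y
    rw [← t.2, one_mul]
  simpa using h 1

section Octonion

variable {k C : Type*} [Field k] [NonAssocRing C] [Module k C]
  [IsScalarTower k C C] [SMulCommClass k C C]

namespace OctonionAlgebra

variable (O : OctonionAlgebra k C)

protected theorem finite (O : OctonionAlgebra k C) : Module.Finite k C :=
  Module.finite_of_finrank_pos (by rw [O.finrank_eq]; norm_num)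

protected theorem nontrivial (O : OctonionAlgebra k C) : Nontrivial C :=
  Module.nontrivial_of_finrank_pos (R := k) (by rw [O.finrank_eq]; norm_num)

theorem ext_polar {x y : C} (h : ∀ z, polar O.norm x z = polar O.norm y z) : x = y := by
  rw [← sub_eq_zero]
  apply O.nondegenerate.1
  intro z
  change polar O.norm (x - y) z = 0
  rw [polar_sub_left, h, sub_self]

theorem polar_mul_mul_left (x y z : C) :
    polar O.norm (x * y) (x * z) = O.norm x * polar O.norm y z := by
  simp only [polar, ← mul_add, O.norm_mul]; ring

theorem polar_mul_mul_right (x y z : C) :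
    polar O.norm (y * x) (z * x) = polar O.norm y z * O.norm x := by
  simp only [polar, ← add_mul, O.norm_mul]; ring

theorem polar_mul_add (x w y z : C) :
    polar O.norm (x * y) (w * z) + polar O.norm (w * y) (x * z)
      = polar O.norm x w * polar O.norm y z := by
  have h := O.polar_mul_mul_left (x + w) y z
  have hN : O.norm (x + w) = polar O.norm x w + O.norm x + O.norm w := by
    simp only [polar]; ring
  rw [hN, add_mul, add_mul, polar_add_left, polar_add_right, polar_add_right,
    O.polar_mul_mul_left, O.polar_mul_mul_left] at h
  linear_combination h

/-- The canonical involution `x ↦ N(x, 1) 1 - x`. -/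
def conj (x : C) : C := polar O.norm x 1 • (1 : C) - x

theorem polar_mul_left (x y z : C) :
    polar O.norm (x * y) z = polar O.norm y (O.conj x * z) := by
  have h := O.polar_mul_add x 1 y z
  simp only [one_mul] at h
  rw [conj, sub_mul, smul_mul_assoc, one_mul, polar_sub_right, polar_smul_right, smul_eq_mul]
  linear_combination h

theorem polar_mul_left' (x y z : C) :
    polar O.norm (O.conj x * y) z = polar O.norm y (x * z) := by
  rw [polar_comm, polar_comm _ y, O.polar_mul_left]

theorem conj_mul_mul (x y : C) : O.conj x * (x * y) = O.norm x • y := by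
  apply O.ext_polar
  intro z
  rw [O.polar_mul_left', O.polar_mul_mul_left, polar_smul_left, smul_eq_mul]

theorem conj_mul_self (x : C) : O.conj x * x = O.norm x • (1 : C) := by
  simpa using O.conj_mul_mul x 1

theorem mul_self_eq (x : C) :
    x * x = polar O.norm x 1 • x - O.norm x • (1 : C) := by
  have h := O.conj_mul_self x
  rw [conj, sub_mul, smul_mul_assoc, one_mul] at h
  rw [← h]; abel

theorem left_alternative (O : OctonionAlgebra k C) (x y : C) : (x * x) * y = x * (x * y) := by
  have h := O.conj_mul_mul x y
  rw [conj, sub_mul, smul_mul_assoc, one_mul] at h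
  rw [O.mul_self_eq, sub_mul, smul_mul_assoc, smul_mul_assoc, one_mul, ← h]; abel

theorem conj_mul_add (x y : C) :
    O.conj x * y + O.conj y * x = polar O.norm x y • (1 : C) := by
  have h := O.conj_mul_self (x + y)
  have hc : O.conj (x + y) = O.conj x + O.conj y := by
    simp only [conj, polar_add_left, add_smul]; abel
  have hN : O.norm (x + y) = polar O.norm x y + O.norm x + O.norm y := by
    simp only [polar]; ring
  rw [hc, add_mul, mul_add, mul_add, O.conj_mul_self, O.conj_mul_self, hN, add_smul,
    add_smul] at h
  rw [← sub_eq_zero] at h ⊢; rw [← h]; abel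

theorem exists_norm_ne_zero : ∃ x, O.norm x ≠ 0 := by
  by_contra! h
  have := O.nontrivial
  obtain ⟨x, hx⟩ := exists_ne (0 : C)
  exact hx (O.ext_polar fun z => by simp [polar, h])

theorem norm_one_ne_zero : O.norm 1 ≠ 0 := by
  obtain ⟨x, hx⟩ := O.exists_norm_ne_zero
  intro h
  apply hx
  rw [← one_mul x, O.norm_mul, h, zero_mul]

/-- Automorphisms preserve the norm. -/
theorem norm_aut (t : Aut k C) (x : C) : O.norm (t.1 x) = O.norm x := by
  have := O.nontrivial
  by_cases hx : ∃ r : k, t.1 x = r • (1 : C)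
  · obtain ⟨r, hr⟩ := hx
    have : x = r • (1 : C) := by
      apply t.1.injective
      rw [hr, map_smul, aut_one]
    rw [hr, ← this]
  · have h1 := O.mul_self_eq (t.1 x)
    have h2 := congrArg t.1 (O.mul_self_eq x)
    rw [t.2, map_sub, map_smul, map_smul, aut_one, h1] at h2
    set p := polar O.norm (t.1 x) 1
    set q := polar O.norm x 1
    have h3 : (p - q) • t.1 x = (O.norm (t.1 x) - O.norm x) • (1 : C) := by
      rw [sub_smul, sub_smul]
      rw [← sub_eq_zero] at h2 ⊢; rw [← h2]; abel
    by_cases hpq : p - q = 0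
    · rw [hpq, zero_smul] at h3
      have := (smul_eq_zero.1 h3.symm).resolve_right one_ne_zero
      exact sub_eq_zero.1 this
    · exfalso
      apply hx
      refine ⟨(p - q)⁻¹ * (O.norm (t.1 x) - O.norm x), ?_⟩
      rw [mul_smul, ← h3, smul_smul, inv_mul_cancel₀ hpq, one_smul]

theorem polar_aut (t : Aut k C) (x y : C) :
    polar O.norm (t.1 x) (t.1 y) = polar O.norm x y := by
  simp only [polar, ← map_add, O.norm_aut]

end OctonionAlgebra

/-- A subalgebra of the octonion algebra `C` which is a quadratic field extension `L` of `k`,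
given by the field `L` and its unital embedding `ι` in `C`. -/
structure QuadraticSubfield (O : OctonionAlgebra k C) (L : Type*) [Field L] [Algebra k L] where
  ι : L →ₙₐ[k] C
  map_one : ι 1 = 1
  finrank_eq : Module.finrank k L = 2

namespace QuadraticSubfield

variable {O : OctonionAlgebra k C} {L : Type*} [Field L] [Algebra k L]
variable (S : QuadraticSubfield O L)

protected theorem finite (S : QuadraticSubfield O L) : Module.Finite k L :=
  Module.finite_of_finrank_pos (by rw [S.finrank_eq]; norm_num)

theorem norm_ι_ne_zero {l : L} (hl : l ≠ 0) : O.norm (S.ι l) ≠ 0 := by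
  intro h
  apply O.norm_one_ne_zero
  rw [← S.map_one, ← mul_inv_cancel₀ hl, map_mul, O.norm_mul, h, zero_mul]

theorem ι_injective : Function.Injective S.ι := by
  rw [injective_iff_map_eq_zero]
  intro l h
  by_contra hl
  exact S.norm_ι_ne_zero hl (by rw [h, QuadraticMap.map_zero])

theorem ι_mul_mul (l m : L) (x : C) : S.ι (l * m) * x = S.ι l * (S.ι m * x) := by
  have hs : ∀ r : k, S.ι (r • 1) = r • (1 : C) := fun r => by rw [map_smul, S.map_one]
  by_cases hl : ∃ r : k, r • (1 : L) = l
  · obtain ⟨r, rfl⟩ := hl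
    rw [smul_one_mul, map_smul, hs, smul_mul_assoc, smul_mul_assoc, one_mul]
  · have := S.finite
    have hli : LinearIndependent k ![(1 : L), l] := by
      rw [LinearIndependent.pair_iff' one_ne_zero]
      exact fun r hr => hl ⟨r, hr⟩
    have htop := hli.span_eq_top_of_card_eq_finrank' (by simp [S.finrank_eq])
    have hm : m ∈ Submodule.span k (Set.range ![(1 : L), l]) := by rw [htop]; trivial
    rw [Matrix.range_cons, Matrix.range_cons, Matrix.range_empty, Set.union_empty,
      Set.singleton_union, Submodule.mem_span_pair] at hm
    obtain ⟨r, s, rfl⟩ := hm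
    rw [mul_add, mul_smul_comm, mul_one, mul_smul_comm]
    simp only [map_add, map_smul, map_mul, S.map_one, add_mul, mul_add, smul_mul_assoc,
      mul_smul_comm, one_mul, O.left_alternative]

/-- The conjugate of an element of `L`, taken in the octonion algebra, lies in `L`. -/
theorem conj_ι (l : L) : ∃ m : L, S.ι m = O.conj (S.ι l) :=
  ⟨polar O.norm (S.ι l) 1 • 1 - l, by
    rw [map_sub, map_smul, S.map_one, OctonionAlgebra.conj]⟩

/-- The orthogonal complement `L^⊥` of `L` in `C`. -/
def perp : Submodule k C :=
  LinearMap.BilinForm.orthogonal (polarBilin O.norm) (LinearMap.range (S.ι : L →ₗ[k] C))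

theorem mem_perp {x : C} : x ∈ S.perp ↔ ∀ l : L, polar O.norm (S.ι l) x = 0 := by
  constructor
  · intro h l
    exact h _ ⟨l, rfl⟩
  · rintro h _ ⟨l, rfl⟩
    exact h l

theorem mul_mem_perp (l : L) {x : C} (hx : x ∈ S.perp) : S.ι l * x ∈ S.perp := by
  rw [mem_perp] at hx ⊢
  intro m
  obtain ⟨n, hn⟩ := S.conj_ι l
  rw [polar_comm, O.polar_mul_left, ← hn, ← map_mul, polar_comm, hx]

/-- `L^⊥` is a left `L`-vector space via the multiplication of the octonion algebra. -/
instance : Module L S.perp where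
  smul l x := ⟨S.ι l * x.1, S.mul_mem_perp l x.2⟩
  one_smul x := Subtype.ext (by change S.ι 1 * x.1 = x.1; rw [S.map_one, one_mul])
  mul_smul l m x := Subtype.ext (S.ι_mul_mul l m x.1)
  smul_zero l := Subtype.ext (mul_zero (S.ι l))
  zero_smul x := Subtype.ext (by change S.ι 0 * x.1 = 0; rw [map_zero, zero_mul])
  smul_add l x y := Subtype.ext (mul_add (S.ι l) x.1 y.1)
  add_smul l m x := Subtype.ext (by
    change S.ι (l + m) * x.1 = S.ι l * x.1 + S.ι m * x.1; rw [map_add, add_mul])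

theorem coe_smul (l : L) (x : S.perp) : ((l • x : S.perp) : C) = S.ι l * x := rfl

instance : IsScalarTower k L S.perp where
  smul_assoc r l x := Subtype.ext (by
    change S.ι (r • l) * x.1 = r • (S.ι l * x.1)
    rw [map_smul, smul_mul_assoc])

theorem finrank_perp : Module.finrank L S.perp = 3 := by
  have := S.finite
  have := O.finite
  have h1 : Module.finrank k S.perp = 8 - 2 := by
    have := LinearMap.BilinForm.finrank_orthogonal O.nondegenerate
      (LinearMap.range (S.ι : L →ₗ[k] C))
    rw [LinearMap.finrank_range_of_inj (f := (S.ι : L →ₗ[k] C)) S.ι_injective,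
      O.finrank_eq, S.finrank_eq] at this
    exact this
  have h2 := Module.finrank_mul_finrank k L S.perp
  rw [h1, S.finrank_eq] at h2
  omega

/-- The form `h(x, y) = N(x, y) + γ⁻¹ N(γ x, y)` on `L^⊥`; it is hermitian when `L = k(γ)` with
`γ² ∈ k`. -/
def herm (γ : L) (x y : S.perp) : L :=
  algebraMap k L (polar O.norm (x : C) (y : C)) +
    γ⁻¹ * algebraMap k L (polar O.norm ((γ • x : S.perp) : C) (y : C))

/-- `G(C/L)`: the group of automorphisms of `C` fixing `L` pointwise. -/
def fixer : Subgroup (Aut k C) where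
  carrier := {t | ∀ l : L, t.1 (S.ι l) = S.ι l}
  one_mem' := fun _ => rfl
  mul_mem' := by
    intro s t hs ht l
    change s.1 (t.1 (S.ι l)) = S.ι l
    rw [ht, hs]
  inv_mem' := by
    intro t ht l
    apply t.1.injective
    rw [ht]
    exact t.1.apply_symm_apply _

/-- The `L`-linear map `L^⊥ → L^⊥` induced by an element of `G(C/L)`. -/
def restrict (t : S.fixer) : S.perp →ₗ[L] S.perp where
  toFun x := ⟨t.1.1 x.1, by
    rw [mem_perp]
    intro l
    rw [← t.2 l, O.polar_aut]
    exact S.mem_perp.1 x.2 l⟩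
  map_add' x y := Subtype.ext (map_add t.1.1 x.1 y.1)
  map_smul' l x := Subtype.ext (by
    change t.1.1 (S.ι l * x.1) = S.ι l * t.1.1 x.1
    rw [t.1.2, t.2 l])

/-- Elements `a ∈ L^⊥` with `N(a) ≠ 0` and `b ∈ D^⊥` with `N(b) ≠ 0`, where `D = L ⊕ L a`; they
exhibit `C` as obtained from `L` by two doublings. -/
structure DoublingPair where
  a : C
  b : C
  a_mem : a ∈ S.perp
  norm_a : O.norm a ≠ 0
  b_orth : ∀ x y : L, polar O.norm (S.ι x + S.ι y * a) b = 0
  norm_b : O.norm b ≠ 0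

namespace DoublingPair

variable {S}
variable (P : S.DoublingPair)

theorem b_mem : P.b ∈ S.perp := by
  rw [mem_perp]
  intro l
  simpa using P.b_orth l 0

theorem b_orth' (y : L) : polar O.norm (S.ι y * P.a) P.b = 0 := by
  simpa using P.b_orth 0 y

theorem conj_a : O.conj P.a = -P.a := by
  have h := S.mem_perp.1 P.a_mem 1
  rw [S.map_one, polar_comm] at h
  rw [OctonionAlgebra.conj, h, zero_smul, zero_sub]

theorem a_mul (l : L) : ∃ m : L, P.a * S.ι l = S.ι m * P.a := by
  obtain ⟨m, hm⟩ := S.conj_ι l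
  refine ⟨m, ?_⟩
  have h := O.conj_mul_add P.a (S.ι l)
  rw [polar_comm, S.mem_perp.1 P.a_mem, zero_smul, P.conj_a, neg_mul, ← hm] at h
  exact (neg_add_eq_zero.1 h)

theorem ab_mem : P.a * P.b ∈ S.perp := by
  rw [mem_perp]
  intro l
  obtain ⟨m, hm⟩ := P.a_mul l
  rw [polar_comm, O.polar_mul_left, P.conj_a, neg_mul, polar_neg_right, hm, polar_comm,
    P.b_orth', neg_zero]

/-- The vectors `f₁ = a`, `f₂ = b`, `f₃ = ab` of `L^⊥`. -/
def vec : Fin 3 → S.perp := ![⟨P.a, P.a_mem⟩, ⟨P.b, P.b_mem⟩, ⟨P.a * P.b, P.ab_mem⟩]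

theorem norm_vec_ne_zero (i : Fin 3) : O.norm (P.vec i : C) ≠ 0 := by
  fin_cases i
  · exact P.norm_a
  · exact P.norm_b
  · change O.norm (P.a * P.b) ≠ 0
    rw [O.norm_mul]
    exact mul_ne_zero P.norm_a P.norm_b

theorem polar_smul_vec {i j : Fin 3} (hij : i < j) (l : L) :
    polar O.norm ((l • P.vec i : S.perp) : C) (P.vec j : C) = 0 := by
  obtain ⟨m, hm⟩ := S.conj_ι l
  have h1 : polar O.norm (S.ι l * P.a) P.b = 0 := P.b_orth' l
  have h2 : polar O.norm (S.ι l * P.a) (P.a * P.b) = 0 := by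
    rw [polar_comm, O.polar_mul_left, P.conj_a, neg_mul, polar_neg_right]
    -- `l a = a l̄`, and `a (a l̄) = a² l̄ ∈ L`
    have e : S.ι l * P.a = P.a * S.ι m := by
      have h := O.conj_mul_add P.a (S.ι m)
      have hc : O.conj (S.ι m) = S.ι l := by
        have hT : polar O.norm (S.ι m) 1 = polar O.norm (S.ι l) 1 := by
          rw [hm, OctonionAlgebra.conj, polar_sub_left, polar_smul_left]
          have h11 : polar O.norm (1 : C) 1 = 2 := by
            have hN1 : O.norm (1 : C) = 1 := by
              have := O.norm_mul 1 1
              rw [mul_one] at this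
              exact (mul_eq_left₀ O.norm_one_ne_zero).1 this.symm
            rw [polar_self, hN1]; norm_num
          rw [h11, smul_eq_mul]; ring
        rw [OctonionAlgebra.conj, hT, hm, OctonionAlgebra.conj]; abel
      rw [polar_comm, S.mem_perp.1 P.a_mem, zero_smul, P.conj_a, neg_mul, hc] at h
      exact (neg_add_eq_zero.1 h).symm
    rw [e, ← O.left_alternative, O.mul_self_eq]
    have h0 := S.mem_perp.1 P.a_mem 1
    rw [S.map_one, polar_comm] at h0
    rw [h0, zero_smul, zero_sub, neg_mul, smul_mul_assoc, one_mul, polar_neg_right,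
      polar_smul_right, polar_comm, S.mem_perp.1 P.b_mem, smul_zero, neg_zero, neg_zero]
  have h3 : polar O.norm (S.ι l * P.b) (P.a * P.b) = 0 := by
    rw [O.polar_mul_mul_right, S.mem_perp.1 P.a_mem, zero_mul]
  fin_cases i <;> fin_cases j <;>
    first | exact absurd hij (by decide) | exact h1 | exact h2 | exact h3

theorem polar_smul_vec_ne {i j : Fin 3} (hij : i ≠ j) (l m : L) :
    polar O.norm ((l • P.vec i : S.perp) : C) ((m • P.vec j : S.perp) : C) = 0 := by
  have key : ∀ {i j : Fin 3} (_ : i < j) (l m : L),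
      polar O.norm ((l • P.vec i : S.perp) : C) ((m • P.vec j : S.perp) : C) = 0 := by
    intro i j hij l m
    obtain ⟨n, hn⟩ := S.conj_ι m
    rw [polar_comm, S.coe_smul m, O.polar_mul_left, ← hn, ← S.coe_smul, smul_smul, polar_comm,
      P.polar_smul_vec hij]
  rcases lt_or_gt_of_ne hij with h | h
  · exact key h l m
  · rw [polar_comm]; exact key h m l

variable [NeZero (2 : k)]

theorem linearIndependent_vec : LinearIndependent L P.vec := by
  rw [Fintype.linearIndependent_iff]
  intro g hg j
  by_contra hj
  have h0 : polar O.norm ((∑ i, g i • P.vec i : S.perp) : C)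
      ((g j • P.vec j : S.perp) : C) = 0 := by
    rw [hg]; exact polar_zero_left _ _
  have h1 : polar O.norm ((∑ i, g i • P.vec i : S.perp) : C) ((g j • P.vec j : S.perp) : C)
      = ∑ i, polar O.norm ((g i • P.vec i : S.perp) : C) ((g j • P.vec j : S.perp) : C) := by
    rw [Fin.sum_univ_three, Fin.sum_univ_three]
    push_cast
    rw [polar_add_left, polar_add_left]
  rw [h1, Finset.sum_eq_single j (fun i _ hi => P.polar_smul_vec_ne hi _ _)
    (fun h => absurd (Finset.mem_univ j) h), polar_self, S.coe_smul, O.norm_mul,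
    two_nsmul, ← two_mul] at h0
  exact mul_ne_zero (NeZero.ne 2)
    (mul_ne_zero (S.norm_ι_ne_zero hj) (P.norm_vec_ne_zero j)) h0

/-- The basis `f₁ = a`, `f₂ = b`, `f₃ = ab` of `L^⊥` over `L`. -/
noncomputable def basis : Module.Basis (Fin 3) L S.perp :=
  haveI : Module.Finite L S.perp :=
    Module.finite_of_finrank_pos (by rw [S.finrank_perp]; norm_num)
  basisOfLinearIndependentOfCardEqFinrank P.linearIndependent_vec (by simp [S.finrank_perp])

theorem coe_basis : ⇑P.basis = P.vec := by
  simp [basis]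

/-- The diagonal matrix `H = diag(h(f₁, f₁), h(f₂, f₂), h(f₃, f₃))`. -/
noncomputable def hermMatrix (γ : L) : Matrix (Fin 3) (Fin 3) L :=
  Matrix.diagonal fun i => S.herm γ (P.basis i) (P.basis i)

/-- The matrix of the restriction to `L^⊥` of an element of `G(C/L)`: its `j`-th column holds the
coordinates of the image of `f_j`. -/
noncomputable def matrix (t : S.fixer) : Matrix (Fin 3) (Fin 3) L :=
  LinearMap.toMatrix P.basis P.basis (S.restrict t)

end DoublingPair

end QuadraticSubfield

end Octonion

/-- `SU(H) = {A ∈ SL(3, L) ∣ ᵗA H Ā = H}`, where `Ā` is obtained by applying `σ` to the entries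
of `A`. -/
def SU {L : Type*} [Field L] (σ : L →+* L) (H : Matrix (Fin 3) (Fin 3) L) :
    Subgroup (Matrix.SpecialLinearGroup (Fin 3) L) where
  carrier := {A | A.1.transpose * H * A.1.map σ = H}
  one_mem' := by simp
  mul_mem' := by
    intro A B hA hB
    change (A.1 * B.1).transpose * H * (A.1 * B.1).map σ = H
    rw [Matrix.transpose_mul, Matrix.map_mul]
    calc _ = B.1.transpose * (A.1.transpose * H * A.1.map σ) * B.1.map σ := by
          simp only [Matrix.mul_assoc]
      _ = H := by rw [hA]; exact hB
  inv_mem' := by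
    intro A hA
    have h1 : A.1 * (A⁻¹).1 = 1 := congrArg Subtype.val (mul_inv_cancel A)
    have h2 : (A⁻¹).1.transpose * A.1.transpose = 1 := by
      rw [← Matrix.transpose_mul, h1, Matrix.transpose_one]
    have h3 : A.1.map σ * (A⁻¹).1.map σ = 1 := by
      rw [← Matrix.map_mul, h1, Matrix.map_one σ (map_zero σ) (map_one σ)]
    change (A⁻¹).1.transpose * H * (A⁻¹).1.map σ = H
    have hA' : A.1.transpose * H * A.1.map σ = H := hA
    calc _ = (A⁻¹).1.transpose * (A.1.transpose * H * A.1.map σ) * (A⁻¹).1.map σ := by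
          rw [hA']
      _ = ((A⁻¹).1.transpose * A.1.transpose) * H * (A.1.map σ * (A⁻¹).1.map σ) := by
          simp only [Matrix.mul_assoc]
      _ = H := by rw [h2, h3, one_mul, mul_one]

end OctonionReality

open OctonionReality

/-! Write `V` for `L^⊥`. The multiplication of `C = L ⊕ V` is recovered from `h` and from `(x, y, z)
↦ h(z, xy)` on `V`: the products between `L` and `V` are `lx` and `xl = σ(l)x`, the `L`-part of `xy`
is governed by `h`, and its `V`-part by the trilinear form. That form is alternating and
`L`-trilinear, so on a 3-dimensional space it is a multiple of the determinant (`volume_eq`). Hence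
an automorphism stabilizing `L` acts on `V` with a matrix in `SU(H)` (`toSU`), and conversely each
`M ∈ SU(H)` makes `x ↦ M σ(x)` extend to an automorphism inducing `σ` on `L`
(`exists_aut_of_mem_SU`).

Conjugacy of `t₀` to its inverse means `t₀ g t₀ = g` for some `g`. Irreducibility excludes the
eigenvalue 1, so the fixed points of `t₀` are exactly `L`, and `g` must stabilize `L`. If `g` were
the identity on `L`, its matrix `B` would satisfy `A B A = B`; in odd dimension with both
determinants 1 this forces `det (1 - A) = 0` (`det_eq_zero_of_conj_inv`), a contradiction. So `g`
induces `σ` on `L`, and for a `σ`-semilinear `g` with matrix `M` the relation `t₀ g t₀ = g` reads `A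
M Ā = M`, which is the conjugacy of `Ā` to `A⁻¹` by `M`. -/

namespace OctonionReality

/-! ### Quadratic extensions generated by a square root -/

section Quadratic

variable {k L : Type*} [Field k] [Field L] [Algebra k L]

/-- `L = k(γ)` is a quadratic extension with `γ² ∈ k`, and `σ` is its nontrivial automorphism. -/
structure IsQuadraticGenerator (γ : L) (σ : L ≃ₐ[k] L) : Prop where
  finrank_eq : Module.finrank k L = 2
  notMem : γ ∉ (algebraMap k L).range
  sq_mem : γ ^ 2 ∈ (algebraMap k L).range
  ne_one : σ ≠ 1

namespace IsQuadraticGenerator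

variable {γ : L} {σ : L ≃ₐ[k] L}

theorem ne_zero (E : IsQuadraticGenerator γ σ) : γ ≠ 0 := by
  rintro rfl
  exact E.notMem (zero_mem _)

theorem exists_eq (E : IsQuadraticGenerator γ σ) (l : L) :
    ∃ r s : k, l = algebraMap k L r + algebraMap k L s * γ := by
  have : Module.Finite k L := Module.finite_of_finrank_pos (by rw [E.finrank_eq]; norm_num)
  have hli : LinearIndependent k ![(1 : L), γ] := by
    rw [LinearIndependent.pair_iff' one_ne_zero]
    exact fun r hr => E.notMem ⟨r, by rw [← hr, Algebra.smul_def, mul_one]⟩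
  have htop := hli.span_eq_top_of_card_eq_finrank' (by simp [E.finrank_eq])
  have hm : l ∈ Submodule.span k (Set.range ![(1 : L), γ]) := by rw [htop]; trivial
  rw [Matrix.range_cons, Matrix.range_cons, Matrix.range_empty, Set.union_empty,
    Set.singleton_union, Submodule.mem_span_pair] at hm
  obtain ⟨r, s, rfl⟩ := hm
  exact ⟨r, s, by rw [Algebra.smul_def, Algebra.smul_def, mul_one]⟩

theorem eq_or_eq_neg (_ : IsQuadraticGenerator γ σ) {m : L} (h : m ^ 2 = γ ^ 2) :
    m = γ ∨ m = -γ := sq_eq_sq_iff_eq_or_eq_neg.1 h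

theorem map_gen (E : IsQuadraticGenerator γ σ) : σ γ = -γ := by
  have h : σ γ ^ 2 = γ ^ 2 := by
    obtain ⟨r, hr⟩ := E.sq_mem
    rw [← map_pow, ← hr, AlgEquiv.commutes]
  refine (E.eq_or_eq_neg h).resolve_left fun h1 => E.ne_one ?_
  ext l
  obtain ⟨r, s, rfl⟩ := E.exists_eq l
  simp [h1]

theorem map_add_inv_mul (E : IsQuadraticGenerator γ σ) (r s : k) :
    σ (algebraMap k L r + γ⁻¹ * algebraMap k L s)
      = algebraMap k L r + γ⁻¹ * algebraMap k L (-s) := by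
  simp [E.map_gen, inv_neg]

/-- Otherwise `γ` would be a quotient of elements of `k`. This is what recovers `N(x, y)` from `h(x,
y)`. -/
theorem left_eq (E : IsQuadraticGenerator γ σ) {r s r' s' : k}
    (h : algebraMap k L r + γ⁻¹ * algebraMap k L s
      = algebraMap k L r' + γ⁻¹ * algebraMap k L s') : r = r' := by
  by_contra hr
  apply E.notMem
  have hr' : algebraMap k L (r - r') ≠ 0 := by
    rw [Ne, map_eq_zero, sub_eq_zero]
    exact hr
  refine ⟨(s' - s) / (r - r'), ?_⟩
  have hγ := E.ne_zero
  rw [map_div₀, div_eq_iff hr', map_sub, map_sub]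
  field_simp at h
  linear_combination -h

end IsQuadraticGenerator

end Quadratic

/-! ### The hermitian form and the trilinear form -/

section Sesquilinear

variable {k C L : Type*} [Field k] [NonAssocRing C] [Module k C]
  [IsScalarTower k C C] [SMulCommClass k C C] {O : OctonionAlgebra k C}
  [Field L] [Algebra k L] {γ : L} {σ : L ≃ₐ[k] L}

namespace OctonionAlgebra

theorem norm_one (O : OctonionAlgebra k C) : O.norm 1 = 1 := by
  have := O.norm_mul 1 1
  rw [mul_one] at this
  exact (mul_eq_left₀ O.norm_one_ne_zero).1 this.symm

end OctonionAlgebra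

namespace QuadraticSubfield

variable (S : QuadraticSubfield O L)

theorem ι_algebraMap (r : k) : S.ι (algebraMap k L r) = r • (1 : C) := by
  rw [Algebra.algebraMap_eq_smul_one, map_smul, S.map_one]

theorem ι_algebraMap_mul (r : k) (x : C) : S.ι (algebraMap k L r) * x = r • x := by
  rw [ι_algebraMap, smul_mul_assoc, one_mul]

/-- If the trace `T` of `γ` were nonzero, `γ² = Tγ - N(γ)` with `γ² ∈ k` could be solved for `γ` in
`k`. -/
theorem polar_gen_one (E : IsQuadraticGenerator γ σ) : polar O.norm (S.ι γ) 1 = 0 := by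
  by_contra h
  apply E.notMem
  obtain ⟨r, hr⟩ := E.sq_mem
  have h1 := O.mul_self_eq (S.ι γ)
  rw [← map_mul, ← pow_two, ← hr, ← S.map_one, ← map_smul, ← map_smul, ← map_sub] at h1
  have h2 := S.ι_injective h1
  rw [S.map_one, Algebra.smul_def, Algebra.smul_def, mul_one] at h2
  have h' : algebraMap k L (polar O.norm (S.ι γ) 1) ≠ 0 := by simpa using h
  refine ⟨(r + O.norm (S.ι γ)) / polar O.norm (S.ι γ) 1, ?_⟩
  rw [map_div₀, div_eq_iff h', map_add]
  linear_combination h2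

theorem conj_ι_eq (E : IsQuadraticGenerator γ σ) (l : L) : O.conj (S.ι l) = S.ι (σ l) := by
  obtain ⟨r, s, rfl⟩ := E.exists_eq l
  have h11 : polar O.norm (1 : C) 1 = 2 := by
    rw [polar_self, O.norm_one]; norm_num
  have hs : S.ι (algebraMap k L s * γ) = s • S.ι γ := by rw [← Algebra.smul_def, map_smul]
  rw [OctonionAlgebra.conj, map_add, map_add, map_mul σ, AlgEquiv.commutes, AlgEquiv.commutes,
    E.map_gen, mul_neg, map_add, map_neg, hs, ι_algebraMap, polar_add_left, polar_smul_left,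
    polar_smul_left, S.polar_gen_one E, h11, smul_zero, add_zero, smul_eq_mul, mul_comm, mul_smul,
    ofNat_smul_eq_nsmul, two_nsmul]
  abel

theorem polar_ι_mul (E : IsQuadraticGenerator γ σ) (l : L) (x y : C) :
    polar O.norm (S.ι l * x) y = polar O.norm x (S.ι (σ l) * y) := by
  rw [O.polar_mul_left, S.conj_ι_eq E]

/-- The form `N(x, y) + γ⁻¹ N(γ x, y)` on the whole octonion algebra. -/
def sesq (γ : L) (x y : C) : L :=
  algebraMap k L (polar O.norm x y) + γ⁻¹ * algebraMap k L (polar O.norm (S.ι γ * x) y)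

theorem herm_eq_sesq (x y : S.perp) : S.herm γ x y = S.sesq γ (x : C) (y : C) := rfl

theorem sesq_add_left (x y z : C) : S.sesq γ (x + y) z = S.sesq γ x z + S.sesq γ y z := by
  simp only [sesq, mul_add, polar_add_left, map_add]; ring

theorem sesq_add_right (x y z : C) : S.sesq γ x (y + z) = S.sesq γ x y + S.sesq γ x z := by
  simp only [sesq, mul_add, polar_add_right, map_add]; ring

theorem sesq_smul_left (r : k) (x y : C) :
    S.sesq γ (r • x) y = algebraMap k L r * S.sesq γ x y := by
  simp only [sesq, mul_smul_comm, polar_smul_left, smul_eq_mul, map_mul]; ring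

/-- Since `γ²` is a scalar, multiplication by `γ` interchanges the two terms of the form up to the
factor `γ`. -/
theorem sesq_gen_mul_left (E : IsQuadraticGenerator γ σ) (x y : C) :
    S.sesq γ (S.ι γ * x) y = γ * S.sesq γ x y := by
  obtain ⟨r, hr⟩ := E.sq_mem
  have hγ := E.ne_zero
  simp only [sesq]
  rw [← S.ι_mul_mul, ← pow_two, ← hr, ι_algebraMap_mul, polar_smul_left, smul_eq_mul, map_mul, hr]
  field_simp
  ring

theorem sesq_ι_mul_left (E : IsQuadraticGenerator γ σ) (l : L) (x y : C) :
    S.sesq γ (S.ι l * x) y = l * S.sesq γ x y := by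
  obtain ⟨r, s, rfl⟩ := E.exists_eq l
  rw [map_add, add_mul, sesq_add_left, ι_algebraMap_mul, sesq_smul_left, S.ι_mul_mul,
    ι_algebraMap_mul, sesq_smul_left, S.sesq_gen_mul_left E]
  ring

theorem sesq_comm (E : IsQuadraticGenerator γ σ) (x y : C) :
    S.sesq γ y x = σ (S.sesq γ x y) := by
  simp only [sesq]
  rw [E.map_add_inv_mul, polar_comm _ y x, polar_comm _ _ x, S.polar_ι_mul E γ x, E.map_gen,
    map_neg, map_neg, neg_mul, polar_neg_right, map_neg, neg_neg]

theorem sesq_ι_mul_right (E : IsQuadraticGenerator γ σ) (l : L) (x y : C) :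
    S.sesq γ x (S.ι l * y) = σ l * S.sesq γ x y := by
  rw [S.sesq_comm E, S.sesq_ι_mul_left E, map_mul, ← S.sesq_comm E]

theorem polar_eq_of_sesq_eq (E : IsQuadraticGenerator γ σ) {x y x' y' : C}
    (h : S.sesq γ x' y' = S.sesq γ x y) : polar O.norm x' y' = polar O.norm x y :=
  E.left_eq h

/-- Applying `σ` only changes the sign of the `γ⁻¹`-component; `N(x, y)` is the other component. -/
theorem polar_eq_of_sesq_eq_map (E : IsQuadraticGenerator γ σ) {x y x' y' : C}
    (h : S.sesq γ x' y' = σ (S.sesq γ x y)) : polar O.norm x' y' = polar O.norm x y := by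
  simp only [sesq] at h
  rw [E.map_add_inv_mul] at h
  exact E.left_eq h

theorem sesq_one_one (E : IsQuadraticGenerator γ σ) : S.sesq γ (1 : C) 1 = 2 := by
  simp only [sesq]
  rw [mul_one, S.polar_gen_one E, polar_self, O.norm_one, map_zero, mul_zero, add_zero,
    nsmul_eq_mul, mul_one, Nat.cast_ofNat, map_ofNat]

theorem sesq_self (E : IsQuadraticGenerator γ σ) (x : C) :
    S.sesq γ x x = algebraMap k L (2 * O.norm x) := by
  have h : polar O.norm (S.ι γ * x) (1 * x) = 0 := by
    rw [O.polar_mul_mul_right, S.polar_gen_one E, zero_mul]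
  rw [one_mul] at h
  rw [sesq, h, polar_self]
  simp

theorem sesq_ι_left_eq_zero (l : L) {x : C} (hx : x ∈ S.perp) :
    S.sesq γ (S.ι l) x = 0 := by
  rw [sesq, ← map_mul, S.mem_perp.1 hx, S.mem_perp.1 hx]
  simp

theorem sesq_ι_right_eq_zero (E : IsQuadraticGenerator γ σ) (l : L) {x : C} (hx : x ∈ S.perp) :
    S.sesq γ x (S.ι l) = 0 := by
  rw [S.sesq_comm E, S.sesq_ι_left_eq_zero l hx, map_zero]

theorem mem_perp_of_sesq (E : IsQuadraticGenerator γ σ) {x : C} (h : S.sesq γ x 1 = 0) :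
    x ∈ S.perp := by
  rw [mem_perp]
  intro l
  rw [polar_comm, ← polar_zero_left (Q := O.norm) (S.ι l)]
  apply S.polar_eq_of_sesq_eq E
  rw [← mul_one (S.ι l), S.sesq_ι_mul_right E, h, S.sesq_ι_mul_right E]
  simp [sesq]

section

variable [NeZero (2 : k)]

theorem two_ne_zero (_ : QuadraticSubfield O L) : (2 : L) ≠ 0 := by
  rw [← map_ofNat (algebraMap k L) 2, Ne, map_eq_zero]
  exact NeZero.ne 2

theorem exists_eq_add (E : IsQuadraticGenerator γ σ) (x : C) :
    ∃ (l : L) (v : S.perp), x = S.ι l + v := by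
  -- Orthogonal projection onto `L`; the 2 is `h(1, 1)`.
  refine ⟨S.sesq γ x 1 / 2, ⟨x - S.ι (S.sesq γ x 1 / 2), S.mem_perp_of_sesq E ?_⟩, by simp⟩
  rw [sub_eq_add_neg, ← map_neg, ← mul_one (S.ι _), sesq_add_left, S.sesq_ι_mul_left E,
    S.sesq_one_one E]
  have := S.two_ne_zero
  field_simp
  ring

end

theorem conj_perp {x : C} (hx : x ∈ S.perp) : O.conj x = -x := by
  have h := S.mem_perp.1 hx 1
  rw [S.map_one, polar_comm] at h
  rw [OctonionAlgebra.conj, h, zero_smul, zero_sub]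

/-- Polarizing `x̄x = N(x)` at the orthogonal pair `x`, `l` gives `x̄l + l̄x = 0`, and `x̄ = -x`. -/
theorem perp_mul_ι (E : IsQuadraticGenerator γ σ) {x : C} (hx : x ∈ S.perp) (l : L) :
    x * S.ι l = S.ι (σ l) * x := by
  have h := O.conj_mul_add x (S.ι l)
  rw [polar_comm, S.mem_perp.1 hx, zero_smul, S.conj_perp hx, neg_mul, S.conj_ι_eq E] at h
  exact neg_add_eq_zero.1 h

theorem polar_perp_mul_ι (E : IsQuadraticGenerator γ σ) {x : C} (hx : x ∈ S.perp) (y : C) (l : L) :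
    polar O.norm (x * y) (S.ι l) = -polar O.norm y (S.ι (σ l) * x) := by
  rw [O.polar_mul_left, S.conj_perp hx, neg_mul, polar_neg_right, S.perp_mul_ι E hx]

theorem perp_mul_self {x : C} (hx : x ∈ S.perp) : x * x = -(O.norm x • (1 : C)) := by
  have h := O.conj_mul_self x
  rw [S.conj_perp hx, neg_mul] at h
  rw [← h, neg_neg]

/-! The trilinear form `h(z, x y)` on `L^⊥`. -/

theorem sesq_mul_self_right (E : IsQuadraticGenerator γ σ) {x z : C} (hx : x ∈ S.perp)
    (hz : z ∈ S.perp) : S.sesq γ z (x * x) = 0 := by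
  rw [S.perp_mul_self hx, ← neg_smul, ← S.ι_algebraMap, S.sesq_ι_right_eq_zero E _ hz]

theorem sesq_left_mul (E : IsQuadraticGenerator γ σ) {x y : C} (hx : x ∈ S.perp)
    (hy : y ∈ S.perp) : S.sesq γ x (x * y) = 0 := by
  have h1 : polar O.norm (x * 1) (x * y) = 0 := by
    rw [O.polar_mul_mul_left, ← S.map_one, S.mem_perp.1 hy, mul_zero]
  have h2 : polar O.norm (S.ι γ * x) (x * y) = 0 := by
    -- Here `γx = x(-γ)`, so the common left factor `x` splits off by composition.
    rw [← neg_neg γ, ← E.map_gen, ← map_neg, ← S.perp_mul_ι E hx, O.polar_mul_mul_left,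
      S.mem_perp.1 hy, mul_zero]
  rw [mul_one] at h1
  rw [sesq, h1, h2]
  simp

theorem sesq_left_mul' {x y : C} (hx : x ∈ S.perp) : S.sesq γ y (x * y) = 0 := by
  have h1 : polar O.norm (1 * y) (x * y) = 0 := by
    rw [O.polar_mul_mul_right, ← S.map_one, S.mem_perp.1 hx, zero_mul]
  have h2 : polar O.norm (S.ι γ * y) (x * y) = 0 := by
    rw [O.polar_mul_mul_right, S.mem_perp.1 hx, zero_mul]
  rw [one_mul] at h1
  rw [sesq, h1, h2]
  simp

/-- Polarization of `h(x, xy) = 0` in `x`. -/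
theorem sesq_mul_swap (E : IsQuadraticGenerator γ σ) {x y z : C} (hx : x ∈ S.perp)
    (hy : y ∈ S.perp) (hz : z ∈ S.perp) : S.sesq γ x (z * y) = -S.sesq γ z (x * y) := by
  have h := S.sesq_left_mul E (add_mem hx hz) hy
  rw [add_mul, sesq_add_left, sesq_add_right, sesq_add_right, S.sesq_left_mul E hx hy,
    S.sesq_left_mul E hz hy] at h
  linear_combination h

theorem sesq_mul_swap' {x y z : C} (hx : x ∈ S.perp) : S.sesq γ y (x * z) = -S.sesq γ z (x * y) := by
  have h := S.sesq_left_mul' (γ := γ) hx (y := y + z)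
  rw [mul_add, sesq_add_left, sesq_add_right, sesq_add_right, S.sesq_left_mul' hx,
    S.sesq_left_mul' hx] at h
  linear_combination h

/-- The alternating `L`-trilinear form `(x, y, z) ↦ h(z, x y)` on `L^⊥`. -/
def volume (E : IsQuadraticGenerator γ σ) : S.perp [⋀^Fin 3]→ₗ[L] L where
  toFun v := S.sesq γ (v 2 : C) ((v 0 : C) * (v 1 : C))
  map_update_add' := by
    intro inst v i x y
    obtain rfl : inst = instDecidableEqFin 3 := Subsingleton.elim _ _
    fin_cases i
    all_goals
      simp [Function.update, Submodule.coe_add, add_mul, mul_add, sesq_add_left, sesq_add_right]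
  map_update_smul' := by
    intro inst v i l x
    obtain rfl : inst = instDecidableEqFin 3 := Subsingleton.elim _ _
    have key : ∀ (x y : C), S.sesq γ (S.ι l * x) y = l * S.sesq γ x y := S.sesq_ι_mul_left E l
    have hlx := S.mul_mem_perp l x.2
    -- Linearity in a factor of the product is obtained by exchanging that factor with the first
    -- argument of `h`, where linearity is known.
    fin_cases i
    · change S.sesq γ (v 2 : C) ((S.ι l * (x : C)) * (v 1 : C))
        = l * S.sesq γ (v 2 : C) ((x : C) * (v 1 : C))
      rw [← neg_inj, ← S.sesq_mul_swap E hlx (v 1).2 (v 2).2, key, ← mul_neg,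
        ← S.sesq_mul_swap E x.2 (v 1).2 (v 2).2]
    · change S.sesq γ (v 2 : C) ((v 0 : C) * (S.ι l * (x : C)))
        = l * S.sesq γ (v 2 : C) ((v 0 : C) * (x : C))
      rw [← neg_inj, ← S.sesq_mul_swap' (v 0).2, key, ← mul_neg, ← S.sesq_mul_swap' (v 0).2]
    · exact key _ _
  map_eq_zero_of_eq' := by
    intro v i j hv hij
    have h01 : v 0 = v 1 → S.sesq γ (v 2 : C) ((v 0 : C) * (v 1 : C)) = 0 := fun h => by
      rw [h, S.sesq_mul_self_right E (v 1).2 (v 2).2]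
    have h02 : v 0 = v 2 → S.sesq γ (v 2 : C) ((v 0 : C) * (v 1 : C)) = 0 := fun h => by
      rw [h, S.sesq_left_mul E (v 2).2 (v 1).2]
    have h12 : v 1 = v 2 → S.sesq γ (v 2 : C) ((v 0 : C) * (v 1 : C)) = 0 := fun h => by
      rw [h, S.sesq_left_mul' (v 0).2]
    fin_cases i <;> fin_cases j <;>
      first
      | exact absurd rfl hij
      | exact h01 hv
      | exact h02 hv
      | exact h12 hv
      | exact h01 hv.symm
      | exact h02 hv.symm
      | exact h12 hv.symm

theorem volume_apply (E : IsQuadraticGenerator γ σ) (v : Fin 3 → S.perp) :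
    S.volume E v = S.sesq γ (v 2 : C) ((v 0 : C) * (v 1 : C)) := rfl

end QuadraticSubfield

end Sesquilinear

/-! ### Automorphisms stabilizing `L` and extension from `L^⊥` -/

section Automorphisms

variable {k C L : Type*} [Field k] [NonAssocRing C] [Module k C]
  [IsScalarTower k C C] [SMulCommClass k C C] {O : OctonionAlgebra k C}
  [Field L] [Algebra k L] {γ : L} {σ : L ≃ₐ[k] L}

namespace QuadraticSubfield

variable (S : QuadraticSubfield O L)

theorem aut_mem_perp {g : Aut k C} {τ : L ≃ₐ[k] L} (hg : ∀ l, g.1 (S.ι l) = S.ι (τ l)) {x : C}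
    (hx : x ∈ S.perp) : g.1 x ∈ S.perp := by
  rw [mem_perp]
  intro l
  rw [← τ.apply_symm_apply l, ← hg, O.polar_aut, S.mem_perp.1 hx]

/-- As `g` preserves `N` and `τγ = ±γ`, the sign picked up by `γ⁻¹` cancels the one in `g(γx) = ±γ
g(x)`. -/
theorem sesq_aut (E : IsQuadraticGenerator γ σ) {g : Aut k C} {τ : L ≃ₐ[k] L}
    (hg : ∀ l, g.1 (S.ι l) = S.ι (τ l)) (x y : C) :
    S.sesq γ (g.1 x) (g.1 y) = τ (S.sesq γ x y) := by
  have hτ : τ γ ^ 2 = γ ^ 2 := by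
    obtain ⟨r, hr⟩ := E.sq_mem
    rw [← map_pow, ← hr, AlgEquiv.commutes]
  have hgγ := hg γ
  rcases E.eq_or_eq_neg hτ with h | h
  · rw [h] at hgγ
    simp only [sesq, map_add, map_mul, map_inv₀, h, AlgEquiv.commutes]
    rw [← O.polar_aut g x, ← O.polar_aut g (_ * x), g.2, hgγ]
  · rw [h, map_neg] at hgγ
    simp only [sesq, map_add, map_mul, map_inv₀, h, AlgEquiv.commutes]
    rw [← O.polar_aut g x, ← O.polar_aut g (_ * x), g.2, hgγ, neg_mul, polar_neg_left, map_neg,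
      inv_neg, neg_mul_neg]

/-- The semilinear map `L^⊥ → L^⊥` induced by an automorphism which stabilizes `L`. -/
def semiRestrict (g : Aut k C) (τ : L ≃ₐ[k] L) (hg : ∀ l, g.1 (S.ι l) = S.ι (τ l)) :
    S.perp →ₛₗ[(τ : L →+* L)] S.perp where
  toFun x := ⟨g.1 x.1, S.aut_mem_perp hg x.2⟩
  map_add' x y := Subtype.ext (map_add g.1 x.1 y.1)
  map_smul' l x := Subtype.ext (by
    change g.1 (S.ι l * x.1) = S.ι (τ l) * g.1 x.1
    rw [g.2, hg])

/-- The decomposition `C = L ⊕ L^⊥`. -/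
noncomputable def decomp [NeZero (2 : k)] (E : IsQuadraticGenerator γ σ) : (L × S.perp) ≃ₗ[k] C :=
  LinearEquiv.ofBijective ((S.ι : L →ₗ[k] C).coprod S.perp.subtype) <| by
    constructor
    · rw [injective_iff_map_eq_zero]
      rintro ⟨l, v⟩ h
      change S.ι l + (v : C) = 0 at h
      have h1 : S.sesq γ (S.ι l + (v : C)) 1 = 2 * l := by
        have h2 := S.sesq_ι_right_eq_zero E 1 v.2
        rw [S.map_one] at h2
        rw [sesq_add_left, h2, ← mul_one (S.ι l), S.sesq_ι_mul_left E, S.sesq_one_one E]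
        ring
      have h0 : S.sesq γ (0 : C) 1 = 0 := by simp [sesq]
      rw [h, h0, eq_comm, mul_eq_zero] at h1
      have hl := h1.resolve_left S.two_ne_zero
      rw [hl, map_zero, zero_add] at h
      exact Prod.ext hl (Subtype.ext h)
    · intro x
      obtain ⟨l, v, rfl⟩ := S.exists_eq_add E x
      exact ⟨(l, v), rfl⟩

theorem decomp_symm_apply [NeZero (2 : k)] (E : IsQuadraticGenerator γ σ) (l : L) (v : S.perp) :
    (S.decomp E).symm (S.ι l + v) = (l, v) :=
  (S.decomp E).symm_apply_apply (l, v)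

theorem smul_eq_algebraMap_smul (r : k) (v : S.perp) : r • v = algebraMap k L r • v :=
  Subtype.ext (S.ι_algebraMap_mul r v).symm

/-- The `k`-linear map on `C = L ⊕ L^⊥` which is `τ` on `L` and `φ` on `L^⊥`. -/
noncomputable def extend [NeZero (2 : k)] (E : IsQuadraticGenerator γ σ) (τ : L ≃ₐ[k] L)
    (φ : S.perp →ₛₗ[(τ : L →+* L)] S.perp) : C →ₗ[k] C :=
  ((S.ι : L →ₗ[k] C) ∘ₗ (τ.toLinearMap : L →ₗ[k] L)).coprod
    (S.perp.subtype ∘ₗ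
      { toFun := φ
        map_add' := map_add φ
        map_smul' := fun r v => by
          rw [smul_eq_algebraMap_smul, LinearMap.map_smulₛₗ, RingHom.id_apply,
            smul_eq_algebraMap_smul]
          congr 1
          exact τ.commutes r }) ∘ₗ ((S.decomp E).symm : C →ₗ[k] L × S.perp)

theorem extend_apply [NeZero (2 : k)] (E : IsQuadraticGenerator γ σ) (τ : L ≃ₐ[k] L)
    (φ : S.perp →ₛₗ[(τ : L →+* L)] S.perp) (l : L) (v : S.perp) :
    S.extend E τ φ (S.ι l + v) = S.ι (τ l) + φ v := by
  rw [extend, LinearMap.comp_apply, LinearEquiv.coe_coe, decomp_symm_apply]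
  rfl

theorem extend_apply_ι [NeZero (2 : k)] (E : IsQuadraticGenerator γ σ) (τ : L ≃ₐ[k] L)
    (φ : S.perp →ₛₗ[(τ : L →+* L)] S.perp) (l : L) :
    S.extend E τ φ (S.ι l) = S.ι (τ l) := by
  simpa using S.extend_apply E τ φ l 0

theorem extend_apply_perp [NeZero (2 : k)] (E : IsQuadraticGenerator γ σ) (τ : L ≃ₐ[k] L)
    (φ : S.perp →ₛₗ[(τ : L →+* L)] S.perp) (v : S.perp) :
    S.extend E τ φ v = φ v := by
  simpa using S.extend_apply E τ φ 0 v

theorem extend_apply_ι_mul [NeZero (2 : k)] (E : IsQuadraticGenerator γ σ) (τ : L ≃ₐ[k] L)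
    (φ : S.perp →ₛₗ[(τ : L →+* L)] S.perp) (l : L) (x : C) :
    S.extend E τ φ (S.ι l * x) = S.ι (τ l) * S.extend E τ φ x := by
  obtain ⟨m, v, rfl⟩ := S.exists_eq_add E x
  rw [mul_add, ← map_mul, ← coe_smul, extend_apply, extend_apply, LinearMap.map_smulₛₗ, map_mul,
    map_mul, mul_add, coe_smul]
  rfl

/-- A `σ`-semilinear map of `L^⊥` which is compatible with the hermitian form and with the
trilinear form extends to an automorphism of the octonion algebra. -/
theorem exists_aut [NeZero (2 : k)] (E : IsQuadraticGenerator γ σ)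
    (φ : S.perp →ₛₗ[(σ : L →+* L)] S.perp)
    (hφ : ∀ x y : S.perp, S.sesq γ (φ x : C) (φ y) = σ (S.sesq γ (x : C) y))
    (hvol : ∀ v, S.volume E (φ ∘ v) = σ (S.volume E v)) :
    ∃ g : Aut k C, (∀ l, g.1 (S.ι l) = S.ι (σ l)) ∧ ∀ v : S.perp, g.1 v = φ v := by
  set F := S.extend E σ φ with hF
  have hFl : ∀ l, F (S.ι l) = S.ι (σ l) := S.extend_apply_ι E σ φ
  have hFv : ∀ v : S.perp, F v = φ v := S.extend_apply_perp E σ φ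
  have hFm : ∀ l x, F (S.ι l * x) = S.ι (σ l) * F x := S.extend_apply_ι_mul E σ φ
  have hsesq : ∀ x y, S.sesq γ (F x) (F y) = σ (S.sesq γ x y) := by
    intro x y
    obtain ⟨l, v, rfl⟩ := S.exists_eq_add E x
    obtain ⟨m, w, rfl⟩ := S.exists_eq_add E y
    have hll : ∀ l m : L, S.sesq γ (S.ι l) (S.ι m) = l * (σ m * 2) := fun l m => by
      rw [← mul_one (S.ι l), S.sesq_ι_mul_left E, ← mul_one (S.ι m), S.sesq_ι_mul_right E,
        S.sesq_one_one E]
    simp only [map_add, sesq_add_left, sesq_add_right, hFl, hFv, hφ, hll,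
      S.sesq_ι_left_eq_zero _ w.2, S.sesq_ι_left_eq_zero _ (φ w).2,
      S.sesq_ι_right_eq_zero E _ v.2, S.sesq_ι_right_eq_zero E _ (φ v).2, map_mul, map_ofNat,
      map_zero]
  have hiso : ∀ x y, polar O.norm (F x) (F y) = polar O.norm x y := fun x y =>
    S.polar_eq_of_sesq_eq_map E (hsesq x y)
  have hinj : Function.Injective F := by
    rw [injective_iff_map_eq_zero]
    intro x hx
    apply O.ext_polar
    intro z
    rw [← hiso, hx, polar_zero_left, polar_zero_left]
  have := O.finite
  have hsurj : Function.Surjective F := LinearMap.injective_iff_surjective.1 hinj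
  -- By nondegeneracy it suffices to pair with the image of `L ⊕ L^⊥`: against `L` only isometry and
  -- semilinearity are needed, against `L^⊥` the hypothesis on the trilinear form.
  have hperp : ∀ v w : S.perp, F ((v : C) * w) = F v * F w := by
    intro v w
    apply O.ext_polar
    intro z
    obtain ⟨z, rfl⟩ := hsurj z
    obtain ⟨m, u, rfl⟩ := S.exists_eq_add E z
    rw [hiso, map_add, polar_add_right, polar_add_right, hFl]
    congr 1
    · rw [hFv v, S.polar_perp_mul_ι E v.2, S.polar_perp_mul_ι E (φ v).2, ← hFv, ← hFm, hiso]
    · rw [polar_comm, polar_comm _ (F v * F w), hFv, hFv, hFv]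
      exact (S.polar_eq_of_sesq_eq_map E (hvol ![v, w, u])).symm
  have hmul : ∀ x y, F (x * y) = F x * F y := by
    intro x y
    obtain ⟨l, v, rfl⟩ := S.exists_eq_add E x
    obtain ⟨m, w, rfl⟩ := S.exists_eq_add E y
    rw [add_mul, map_add, hFm, map_add F (S.ι m), map_add F (S.ι l), add_mul, hFl l, hFl m,
      mul_add (v : C), map_add, hperp, S.perp_mul_ι E v.2, hFm, mul_add (F v), hFv v,
      S.perp_mul_ι E (φ v).2]
  refine ⟨⟨LinearEquiv.ofInjectiveEndo F hinj, fun x y => ?_⟩, fun l => ?_, fun v => ?_⟩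
  · simpa using hmul x y
  · simpa using hFl l
  · simpa using hFv v

end QuadraticSubfield

end Automorphisms

/-! ### Matrices with respect to `a, b, ab` -/

section Coordinates

open Matrix

variable {k C L : Type*} [Field k] [NonAssocRing C] [Module k C]
  [IsScalarTower k C C] [SMulCommClass k C C] {O : OctonionAlgebra k C}
  [Field L] [Algebra k L] {γ : L} {σ : L ≃ₐ[k] L}

namespace QuadraticSubfield

namespace DoublingPair

variable {S : QuadraticSubfield O L} (P : S.DoublingPair) [NeZero (2 : k)]

theorem sesq_basis_ne {i j : Fin 3} (hij : i ≠ j) :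
    S.sesq γ (P.basis i : C) (P.basis j) = 0 := by
  have h1 := P.polar_smul_vec_ne hij 1 1
  have h2 := P.polar_smul_vec_ne hij γ 1
  rw [one_smul] at h2
  rw [one_smul, one_smul] at h1
  rw [P.coe_basis, sesq, h1, ← coe_smul, h2]
  simp

/-- The diagonal values are `2 N(fᵢ) ∈ k`. Hence `H` is fixed by `σ`, so `SU(H)` is stable under `A
↦ Ā` and semilinear isometries also give matrices in it. -/
theorem map_sesq_basis (E : IsQuadraticGenerator γ σ) (τ : L ≃ₐ[k] L) (i : Fin 3) :
    τ (S.sesq γ (P.basis i : C) (P.basis i)) = S.sesq γ (P.basis i : C) (P.basis i) := by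
  rw [S.sesq_self E, τ.commutes]

theorem sesq_basis_self_ne_zero (E : IsQuadraticGenerator γ σ) (i : Fin 3) :
    S.sesq γ (P.basis i : C) (P.basis i) ≠ 0 := by
  rw [S.sesq_self E, Ne, map_eq_zero, P.coe_basis]
  exact mul_ne_zero (NeZero.ne 2) (P.norm_vec_ne_zero i)

theorem map_hermMatrix (E : IsQuadraticGenerator γ σ) (τ : L ≃ₐ[k] L) :
    (P.hermMatrix γ).map τ = P.hermMatrix γ := by
  ext i j
  rcases eq_or_ne i j with rfl | h
  · simpa [hermMatrix, herm_eq_sesq] using P.map_sesq_basis E τ i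
  · simp [hermMatrix, h]

theorem sesq_sum_left (E : IsQuadraticGenerator γ σ) (c : Fin 3 → L) (y : C) :
    S.sesq γ ((∑ i, c i • P.basis i : S.perp) : C) y
      = ∑ i, c i * S.sesq γ (P.basis i : C) y := by
  rw [Fin.sum_univ_three, Fin.sum_univ_three, Submodule.coe_add, Submodule.coe_add, sesq_add_left,
    sesq_add_left, coe_smul, coe_smul, coe_smul, S.sesq_ι_mul_left E, S.sesq_ι_mul_left E,
    S.sesq_ι_mul_left E]

theorem sesq_eq_dotProduct (E : IsQuadraticGenerator γ σ) (x y : S.perp) :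
    S.sesq γ (x : C) y
      = (P.basis.repr x : Fin 3 → L) ⬝ᵥ (P.hermMatrix γ *ᵥ fun i => σ (P.basis.repr y i)) := by
  have h : ∀ i, S.sesq γ (P.basis i : C) y
      = S.sesq γ (P.basis i : C) (P.basis i) * σ (P.basis.repr y i) := by
    intro i
    conv_lhs => rw [← P.basis.sum_repr y]
    rw [S.sesq_comm E, P.sesq_sum_left E, Finset.sum_eq_single i, map_mul, ← S.sesq_comm E,
      mul_comm]
    · intro j _ hj
      rw [P.sesq_basis_ne (γ := γ) hj, mul_zero]
    · simp
  conv_lhs => rw [← P.basis.sum_repr x]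
  rw [P.sesq_sum_left E]
  simp only [dotProduct, hermMatrix, mulVec_diagonal, h, herm_eq_sesq]

/-- The matrix of a semilinear map with respect to `f₁, f₂, f₃`. -/
noncomputable def semiMatrix {τ : L ≃ₐ[k] L} (φ : S.perp →ₛₗ[(τ : L →+* L)] S.perp) :
    Matrix (Fin 3) (Fin 3) L :=
  Matrix.of fun i j => P.basis.repr (φ (P.basis j)) i

theorem repr_semilinear {τ : L ≃ₐ[k] L} (φ : S.perp →ₛₗ[(τ : L →+* L)] S.perp) (x : S.perp) :
    (P.basis.repr (φ x) : Fin 3 → L) = P.semiMatrix φ *ᵥ fun j => τ (P.basis.repr x j) := by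
  ext i
  conv_lhs => rw [← P.basis.sum_repr x]
  simp only [map_sum, LinearMap.map_smulₛₗ, map_smul, Finsupp.coe_finsetSum, Finset.sum_apply,
    Finsupp.coe_smul, Pi.smul_apply, smul_eq_mul, mulVec, dotProduct, semiMatrix, of_apply]
  exact Finset.sum_congr rfl fun _ _ => mul_comm _ _

/-- The semilinear map with a given matrix. -/
noncomputable def ofMatrix (τ : L ≃ₐ[k] L) (M : Matrix (Fin 3) (Fin 3) L) :
    S.perp →ₛₗ[(τ : L →+* L)] S.perp where
  toFun x := P.basis.equivFun.symm (M *ᵥ fun j => τ (P.basis.repr x j))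
  map_add' x y := by
    rw [← map_add, ← mulVec_add]
    congr 2
    ext j
    simp
  map_smul' l x := by
    rw [← map_smul, ← mulVec_smul]
    congr 2
    ext j
    simp

theorem repr_ofMatrix (τ : L ≃ₐ[k] L) (M : Matrix (Fin 3) (Fin 3) L) (x : S.perp) :
    (P.basis.repr (P.ofMatrix τ M x) : Fin 3 → L) = M *ᵥ fun j => τ (P.basis.repr x j) :=
  P.basis.equivFun.apply_symm_apply _

/-- The constant is the value on the basis, `h(f₃, f₁f₂) = h(f₃, f₃)`, because `f₃ = f₁f₂`. -/
theorem volume_eq (E : IsQuadraticGenerator γ σ) (v : Fin 3 → S.perp) :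
    S.volume E v
      = S.sesq γ (P.basis 2 : C) (P.basis 2) * (P.basis.toMatrix v).det := by
  rw [(S.volume E).eq_smul_basis_det P.basis, AlternatingMap.smul_apply, Module.Basis.det_apply,
    smul_eq_mul, volume_apply, P.coe_basis]
  rfl

/-- Only the coordinate formula for `φ` matters, so this serves both `semiRestrict` and `ofMatrix`.
-/
theorem toMatrix_comp {τ : L ≃ₐ[k] L} {φ : S.perp → S.perp} {M : Matrix (Fin 3) (Fin 3) L}
    (h : ∀ x, (P.basis.repr (φ x) : Fin 3 → L) = M *ᵥ fun j => τ (P.basis.repr x j))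
    (v : Fin 3 → S.perp) : P.basis.toMatrix (φ ∘ v) = M * (P.basis.toMatrix v).map τ := by
  ext i j
  rw [Module.Basis.toMatrix_apply, Function.comp_apply, h]
  rfl

theorem det_toMatrix_comp {τ : L ≃ₐ[k] L} {φ : S.perp → S.perp} {M : Matrix (Fin 3) (Fin 3) L}
    (h : ∀ x, (P.basis.repr (φ x) : Fin 3 → L) = M *ᵥ fun j => τ (P.basis.repr x j))
    (v : Fin 3 → S.perp) :
    (P.basis.toMatrix (φ ∘ v)).det = M.det * τ (P.basis.toMatrix v).det := by
  rw [P.toMatrix_comp h, det_mul, ← AlgEquiv.mapMatrix_apply, ← AlgEquiv.map_det]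

/-- On the basis the trilinear form takes a nonzero value in `k`; `g` transforms it by `τ`, hence
fixes it, but also multiplies it by the determinant. -/
theorem det_semiMatrix (E : IsQuadraticGenerator γ σ) {g : Aut k C} {τ : L ≃ₐ[k] L}
    (hg : ∀ l, g.1 (S.ι l) = S.ι (τ l)) : (P.semiMatrix (S.semiRestrict g τ hg)).det = 1 := by
  have h : S.volume E (S.semiRestrict g τ hg ∘ P.basis) = τ (S.volume E P.basis) := by
    rw [volume_apply, volume_apply, ← S.sesq_aut E hg, g.2]
    rfl
  rw [P.volume_eq E, P.volume_eq E, map_mul, P.map_sesq_basis E,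
    P.det_toMatrix_comp (P.repr_semilinear _), Module.Basis.toMatrix_self, det_one, _root_.map_one,
    mul_one] at h
  exact mul_left_cancel₀ (P.sesq_basis_self_ne_zero E 2) h

theorem semiMatrix_unitary (E : IsQuadraticGenerator γ σ) {g : Aut k C} {τ : L ≃ₐ[k] L}
    (hg : ∀ l, g.1 (S.ι l) = S.ι (τ l)) :
    (P.semiMatrix (S.semiRestrict g τ hg))ᵀ * P.hermMatrix γ
      * (P.semiMatrix (S.semiRestrict g τ hg)).map σ = P.hermMatrix γ := by
  ext i j
  have h1 : S.sesq γ (S.semiRestrict g τ hg (P.basis i) : C) (S.semiRestrict g τ hg (P.basis j))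
      = τ (S.sesq γ (P.basis i : C) (P.basis j)) := S.sesq_aut E hg _ _
  rw [P.sesq_eq_dotProduct E] at h1
  rw [Matrix.mul_assoc]
  refine h1.trans ?_
  rcases eq_or_ne i j with rfl | h
  · rw [P.map_sesq_basis E, hermMatrix, diagonal_apply_eq, herm_eq_sesq]
  · rw [P.sesq_basis_ne (γ := γ) h, map_zero, hermMatrix, diagonal_apply_ne _ h]

/-- The element of `SU(H)` given by an automorphism of `C` which stabilizes `L`. -/
noncomputable def toSU (E : IsQuadraticGenerator γ σ) {g : Aut k C} {τ : L ≃ₐ[k] L}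
    (hg : ∀ l, g.1 (S.ι l) = S.ι (τ l)) : SU (σ : L →+* L) (P.hermMatrix γ) :=
  ⟨⟨P.semiMatrix (S.semiRestrict g τ hg), P.det_semiMatrix E hg⟩, P.semiMatrix_unitary E hg⟩

/-- Every element of `SU(H)` is, up to `σ`, induced by an automorphism of `C`. -/
theorem exists_aut_of_mem_SU (E : IsQuadraticGenerator γ σ)
    (M : SU (σ : L →+* L) (P.hermMatrix γ)) :
    ∃ g : Aut k C, (∀ l, g.1 (S.ι l) = S.ι (σ l)) ∧
      ∀ v : S.perp, g.1 v = P.ofMatrix σ M.1.1 v := by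
  refine S.exists_aut E (P.ofMatrix σ M.1.1) (fun x y => ?_) (fun v => ?_)
  · have hM : M.1.1ᵀ * P.hermMatrix γ * M.1.1.map σ = P.hermMatrix γ := M.2
    have e : (fun i => σ ((M.1.1 *ᵥ fun j => σ (P.basis.repr y j)) i))
        = M.1.1.map σ *ᵥ fun j => σ (σ (P.basis.repr y j)) := by
      ext i
      simp [mulVec, dotProduct]
    rw [P.sesq_eq_dotProduct E, P.repr_ofMatrix, P.repr_ofMatrix, e, ← vecMul_transpose,
      ← dotProduct_mulVec, mulVec_mulVec, mulVec_mulVec, hM,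
      P.sesq_eq_dotProduct E]
    -- Since `H = H̄`, the whole expression becomes `σ` applied to the coordinate formula for `h(x,
    -- y)`.
    conv_lhs => rw [← P.map_hermMatrix E σ]
    simp [dotProduct, mulVec]
  · rw [P.volume_eq E, P.volume_eq E, P.det_toMatrix_comp (P.repr_ofMatrix _ _), M.1.2, one_mul,
      map_mul, P.map_sesq_basis E]

theorem matrix_eq_semiMatrix (t : S.fixer) :
    P.matrix t = P.semiMatrix (S.semiRestrict t.1 AlgEquiv.refl t.2) := by
  ext i j
  rw [matrix, LinearMap.toMatrix_apply]
  rfl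

theorem det_matrix (E : IsQuadraticGenerator γ σ) (t : S.fixer) : (P.matrix t).det = 1 :=
  (congrArg det (P.matrix_eq_semiMatrix t)).trans (P.det_semiMatrix E _)

theorem repr_restrict (t : S.fixer) (x : S.perp) :
    (P.basis.repr (S.restrict t x) : Fin 3 → L) = P.matrix t *ᵥ (P.basis.repr x : Fin 3 → L) := by
  rw [matrix, LinearMap.toMatrix_mulVec_repr]

/-- `Ā` belongs to `SU(H)` when `A` does. -/
theorem map_mem_SU (E : IsQuadraticGenerator γ σ) {A : Matrix (Fin 3) (Fin 3) L}
    (hA : Aᵀ * P.hermMatrix γ * A.map σ = P.hermMatrix γ) :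
    (A.map σ)ᵀ * P.hermMatrix γ * (A.map σ).map σ = P.hermMatrix γ := by
  have h := congrArg (fun B => B.map σ) hA
  simp only [Matrix.map_mul, P.map_hermMatrix E] at h
  exact h

end DoublingPair

end QuadraticSubfield

/-! ### Determinants and the eigenvalue 1 -/

section Charpoly

variable {F : Type*} [Field F]

/-- An irreducible cubic has no root in the field. -/
theorem det_one_sub_ne_zero {A : Matrix (Fin 3) (Fin 3) F} (hirr : Irreducible A.charpoly) :
    (1 - A).det ≠ 0 := by
  intro h
  have hroot : A.charpoly.IsRoot 1 := by
    rw [Polynomial.IsRoot, eval_charpoly]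
    simpa using h
  have h1 := Polynomial.degree_eq_one_of_irreducible_of_root hirr hroot
  have h2 := Polynomial.natDegree_eq_of_degree_eq_some h1
  rw [charpoly_natDegree_eq_dim, Fintype.card_fin] at h2
  exact absurd h2 (by norm_num)

/-- The relation gives `B(1 - A) = -(1 - A)BA`; taking determinants, the sign is `(-1)³`, so `det (1
- A)` equals its own negative. -/
theorem det_eq_zero_of_conj_inv (h2 : (2 : F) ≠ 0) {A B : Matrix (Fin 3) (Fin 3) F}
    (hA : A.det = 1) (hB : B.det = 1) (h : A * B * A = B) : (1 - A).det = 0 := by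
  have h1 : B * (1 - A) = -(1 - A) * B * A := by
    rw [mul_sub, mul_one, neg_sub, sub_mul, sub_mul, one_mul, h]
  have h3 := congrArg det h1
  rw [det_mul, det_mul, det_mul, det_neg, hA, hB, Fintype.card_fin] at h3
  have h4 : (2 : F) * (1 - A).det = 0 := by linear_combination h3
  exact (mul_eq_zero.1 h4).resolve_left h2

end Charpoly

/-! ### Automorphisms conjugating `t` to its inverse -/

namespace QuadraticSubfield

variable {S : QuadraticSubfield O L} (P : S.DoublingPair) [NeZero (2 : k)]

theorem mem_range_ι_of_fixed (E : IsQuadraticGenerator γ σ) {t : S.fixer}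
    (hirr : Irreducible (P.matrix t).charpoly) {x : C} (hx : t.1.1 x = x) : ∃ l, x = S.ι l := by
  obtain ⟨l, v, rfl⟩ := S.exists_eq_add E x
  have hv : S.restrict t v = v := by
    rw [map_add, t.2] at hx
    exact Subtype.ext (add_left_cancel hx)
  have h := P.repr_restrict t v
  rw [hv] at h
  have h0 : (1 - P.matrix t) *ᵥ (P.basis.repr v : Fin 3 → L) = 0 := by
    rw [sub_mulVec, one_mulVec, ← h, sub_self]
  have h1 := eq_zero_of_mulVec_eq_zero (det_one_sub_ne_zero hirr) h0
  have h2 : v = 0 := P.basis.repr.map_eq_zero_iff.1 (DFunLike.coe_injective h1)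
  exact ⟨l, by rw [h2]; simp⟩

/-- An automorphism conjugating `t` to `t⁻¹` induces `σ` on `L`. -/
theorem apply_ι_of_conj (E : IsQuadraticGenerator γ σ) {t : S.fixer}
    (hirr : Irreducible (P.matrix t).charpoly) {g : Aut k C}
    (hgt : ∀ x, t.1.1 (g.1 (t.1.1 x)) = g.1 x) (l : L) : g.1 (S.ι l) = S.ι (σ l) := by
  -- Since `t` fixes `γ`, `t(g(γ)) = t(g(t(γ))) = g(γ)`.
  have hfix : t.1.1 (g.1 (S.ι γ)) = g.1 (S.ι γ) := by
    conv_lhs => rw [← t.2 γ]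
    exact hgt _
  obtain ⟨m, hm⟩ := S.mem_range_ι_of_fixed P E hirr hfix
  have hg1 : ∀ (τ : L ≃ₐ[k] L), m = τ γ → ∀ l, g.1 (S.ι l) = S.ι (τ l) := by
    intro τ hτ l
    obtain ⟨r, s, rfl⟩ := E.exists_eq l
    simp only [← Algebra.smul_def, map_add, map_smul, hm, ι_algebraMap, aut_one, AlgEquiv.commutes,
      hτ]
  have hm2 : m ^ 2 = γ ^ 2 := by
    apply S.ι_injective
    obtain ⟨r, hr⟩ := E.sq_mem
    rw [pow_two, map_mul, ← hm, ← g.2, ← map_mul, ← pow_two, ← hr, ι_algebraMap, map_smul, aut_one]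
  rcases E.eq_or_eq_neg hm2 with rfl | h
  -- If `g(γ) = γ`, then `g` is `L`-linear on `L^⊥` and its matrix `B` satisfies `A B A = B`.
  · exfalso
    have hg := hg1 AlgEquiv.refl rfl
    have hAB : P.matrix t * P.matrix ⟨g, hg⟩ * P.matrix t = P.matrix ⟨g, hg⟩ := by
      rw [DoublingPair.matrix, DoublingPair.matrix, ← LinearMap.toMatrix_comp,
        ← LinearMap.toMatrix_comp]
      congr 1
      ext x
      exact hgt x
    exact det_one_sub_ne_zero hirr (det_eq_zero_of_conj_inv S.two_ne_zero
      (P.det_matrix E _) (P.det_matrix E _) hAB)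
  · exact hg1 σ (by rw [h, E.map_gen]) l

end QuadraticSubfield

/-- Puts both conjugacy statements in an inverse-free form that transfers directly between
automorphisms and matrices. -/
theorem isConj_inv_iff {G : Type*} [Group G] (a b : G) :
    IsConj a b⁻¹ ↔ ∃ c, b * c * a = c := by
  rw [isConj_iff]
  refine exists_congr fun c => ?_
  rw [mul_inv_eq_iff_eq_mul, eq_inv_mul_iff_mul_eq, mul_assoc]

end Coordinates

end OctonionReality

theorem theorem6p5 {k C L : Type*} [Field k] [NeZero (2 : k)]
    [NonAssocRing C] [Module k C] [IsScalarTower k C C] [SMulCommClass k C C]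
    (O : OctonionAlgebra k C)
    [Field L] [Algebra k L] (S : QuadraticSubfield O L)
    (γ : L) (hγ : γ ∉ (algebraMap k L).range) (hγ2 : γ ^ 2 ∈ (algebraMap k L).range)
    (σ : L ≃ₐ[k] L) (hσ : σ ≠ 1)
    (P : S.DoublingPair)
    (t₀ : S.fixer) (hirr : Irreducible (P.matrix t₀).charpoly) :
    ∃ A A' : SU (σ : L →+* L) (P.hermMatrix γ),
      A.1.1 = P.matrix t₀ ∧ A'.1.1 = (P.matrix t₀).map σ ∧
      (IsConj (t₀ : Aut k C) (t₀ : Aut k C)⁻¹ ↔ IsConj A' A⁻¹) := by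
  have E : IsQuadraticGenerator γ σ := ⟨S.finrank_eq, hγ, hγ2, hσ⟩
  obtain ⟨A, hA⟩ : ∃ A : SU (σ : L →+* L) (P.hermMatrix γ), A.1.1 = P.matrix t₀ :=
    ⟨P.toSU E (τ := AlgEquiv.refl) t₀.2, (P.matrix_eq_semiMatrix t₀).symm⟩
  have hdet : (A.1.1.map σ).det = 1 := by
    rw [← AlgEquiv.mapMatrix_apply, ← AlgEquiv.map_det, A.1.2, map_one]
  refine ⟨A, ⟨⟨A.1.1.map σ, hdet⟩, P.map_mem_SU E A.2⟩, hA, by rw [← hA], ?_⟩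
  rw [isConj_inv_iff, isConj_inv_iff]
  constructor
  · rintro ⟨g, hgt⟩
    have hgt' : ∀ x, t₀.1.1 (g.1 (t₀.1.1 x)) = g.1 x := fun x =>
      congrArg (fun u : Aut k C => u.1 x) hgt
    have hg := QuadraticSubfield.apply_ι_of_conj P E hirr hgt'
    refine ⟨P.toSU E hg, Subtype.ext (Subtype.ext ?_)⟩
    -- Moving the semilinear `g` past the coordinates of `t₀` applies `σ` to them: this is where `Ā`
    -- arises.
    change A.1.1 * P.semiMatrix (S.semiRestrict g σ hg) * A.1.1.map σ
      = P.semiMatrix (S.semiRestrict g σ hg)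
    rw [hA]
    ext i j
    have h : S.restrict t₀ (S.semiRestrict g σ hg (S.restrict t₀ (P.basis j)))
        = S.semiRestrict g σ hg (P.basis j) := Subtype.ext (hgt' _)
    have h1 := P.repr_restrict t₀ (S.semiRestrict g σ hg (S.restrict t₀ (P.basis j)))
    rw [h, P.repr_semilinear _ (S.restrict t₀ (P.basis j)), Matrix.mulVec_mulVec] at h1
    have e : (fun i => σ (P.basis.repr (S.restrict t₀ (P.basis j)) i))
        = fun i => (P.matrix t₀).map σ i j := by
      ext i
      rw [Matrix.map_apply, QuadraticSubfield.DoublingPair.matrix, LinearMap.toMatrix_apply]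
    rw [e] at h1
    exact (congrFun h1 i).symm
  · rintro ⟨M, hM⟩
    obtain ⟨g, hg, hv⟩ := P.exists_aut_of_mem_SU E M
    have hM' : A.1.1 * M.1.1 * A.1.1.map σ = M.1.1 :=
      congrArg (fun B : SU (σ : L →+* L) (P.hermMatrix γ) => B.1.1) hM
    refine ⟨g, Subtype.ext (LinearEquiv.ext fun x => ?_)⟩
    change t₀.1.1 (g.1 (t₀.1.1 x)) = g.1 x
    obtain ⟨l, v, rfl⟩ := S.exists_eq_add E x
    -- On `L^⊥` the required identity is `A M Ā = M` in coordinates; on `L` it is clear, as `t₀` is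
    -- the identity there.
    have h : S.restrict t₀ (P.ofMatrix σ M.1.1 (S.restrict t₀ v)) = P.ofMatrix σ M.1.1 v := by
      apply P.basis.repr.injective
      apply DFunLike.coe_injective
      have e : (fun j => σ ((P.matrix t₀).mulVec (P.basis.repr v) j))
          = ((P.matrix t₀).map σ).mulVec fun j => σ (P.basis.repr v j) := by
        ext i
        simp [Matrix.mulVec, dotProduct]
      rw [P.repr_restrict, P.repr_ofMatrix, P.repr_ofMatrix, P.repr_restrict, e,
        Matrix.mulVec_mulVec, Matrix.mulVec_mulVec, ← hA, hM']
    have h' : t₀.1.1 (P.ofMatrix σ M.1.1 (S.restrict t₀ v)) = P.ofMatrix σ M.1.1 v :=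
      congrArg Subtype.val h
    rw [map_add, map_add, map_add, map_add, t₀.2, hg, t₀.2, hv v, ← h', ← hv]
    rfl
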